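/- Let $M$ be a compact oriented 3-manifold whose boundary consists of tori, and let $\mathcal T$ be an ideal triangulation of $\operatorname{int} M$ with $n$ oriented tetrahedra. Let $Q(\mathcal T;\mathbb Z)\subset\mathbb Z^{3n}$ be the group of integer solutions $S=(a_1,b_1,c_1,\dots,a_n,b_n,c_n)$ of the $Q$-matching equations ($(a_j,b_j,c_j)$ are the coordinates of the three quad types of tetrahedron $j$), $Q(\mathcal T;\mathbb Z_+)$ the set of solutions with non-negative coordinates, and $N(\mathcal T;\mathbb Z_+)\subset Q(\mathcal T;\mathbb Z_+)$ the set of those that are the quad coordinates of closed normal classes, i.e. that satisfy Haken's matching equations together with suitable triangle coordinates. A class is embedded if it has at most one non-zero quad coordinate in each tetrahedron. Let $[S]_2\in H_2(M,\partial M;\mathbb Z/2)$ and $[\partial S]\in H_1(\partial M;\mathbb Z)$ be the homology classes of $S$ and of its boundary. Let $\chi$ be the formal Euler characteristic, i.e. the linear function on $Q(\mathcal T;\mathbb Z)$ that is $-2$ on each edge solution, $-1$ on each tetrahedral solution and $0$ on the peripheral solutions of simple closed non-contractible normal curves on $\partial M$, and let $$\delta(S,S')=\tfrac12\sum_j\big(a_jb_j'+b_jc_j'+c_ja_j'+a_j'b_j+b_j'c_j+c_j'a_j\big).$$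 Let $$I_\Delta(m,e)=\sum_{k\ge\max\{0,-e\}}(-1)^k\frac{q^{\frac12k(k+1)-(k+\frac12e)m}}{(q)_k(q)_{k+e}},\qquad (q)_k=\prod_{i=1}^k(1-q^i),$$ $$J_\Delta(a,b,c)=(-q^{1/2})^{-b}I_\Delta(b-c,a-b),\qquad I(S)=(-q^{1/2})^{-\chi(S)}\prod_{j=1}^nJ_\Delta(a_j,b_j,c_j)\in\mathbb Z((q^{1/2}));$$ $I(S)$ is unchanged when tetrahedral solutions are added to $S$. For $a\in H_2(M,\partial M;\mathbb Z/2)$ and $b\in H_1(\partial M;\mathbb Z)$ the index sum is $$I^a_{\mathcal T}(b)=\sum_{[S]}I([S]),$$ the sum over all classes $[S]$ of elements $S\in Q(\mathcal T;\mathbb Z)$ modulo tetrahedral solutions with $[S]_2=a$ and $[\partial S]=b$. **Theorem.** Suppose that there are no $S\in Q(\mathcal T;\mathbb Z_+)$ with $[\partial S]=b$ and embedded $S'\in N(\mathcal T;\mathbb Z_+)$ with $S'\ne0$ such that $$-\chi(S')+2\,\delta(S,S')\le 0.$$ Then the index sum $I^a_{\mathcal T}(b)$ converges as a formal Laurent series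 in $q^{1/2}$. (The triangulation $\mathcal T$ is not assumed to be 1-efficient.) -/

import Mathlib

open scoped LaurentSeries BigOperators

/-! ## Oriented ideal triangulations -/

/-- A face pairing of `n` oriented tetrahedra with vertices `0,1,2,3`. The face `f` of tetrahedron
`t` is the one opposite to the vertex `f`; it is glued to the face `glue t f f` of `nbr t f`, its
vertex `v ≠ f` going to the vertex `glue t f v`. Oddness of `glue t f` says that the gluing reverses
the orientation of the faces, i.e. that the orientations of the tetrahedra match. -/
structure OrientedGluing (n : ℕ) where
  nbr : Fin n → Fin 4 → Fin n
  glue : Fin n → Fin 4 → Equiv.Perm (Fin 4)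
  nbr_nbr : ∀ t f, nbr (nbr t f) (glue t f f) = t
  glue_glue : ∀ t f, glue (nbr t f) (glue t f f) = (glue t f)⁻¹
  no_self : ∀ t f, ¬ (nbr t f = t ∧ glue t f f = f)
  sign_glue : ∀ t f, Equiv.Perm.sign (glue t f) = -1

/-- A flag is a tetrahedron `t` with two distinct vertices `v, w`. It stands for
* the edge `vw` of `t`, oriented from `v` to `w`;
* the corner `w` of the boundary triangle `(t, v)` (the triangle cutting off the vertex `v`), which
  is the point where the edge `vw` leaves the vertex `v`;
* the side of the boundary triangle `(t, v)` opposite to that corner, which is the normal arc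
  cutting off the vertex `v` in the face of `t` opposite to `w`. -/
@[ext] structure TetFlag (n : ℕ) where
  t : Fin n
  v : Fin 4
  w : Fin 4
  ne : v ≠ w

noncomputable instance (n : ℕ) : DecidableEq (TetFlag n) := Classical.decEq _

instance (n : ℕ) : Finite (TetFlag n) :=
  Finite.of_injective (fun x : TetFlag n => (x.t, x.v, x.w)) (by
    intro x y h
    simp only [Prod.mk.injEq] at h
    exact TetFlag.ext h.1 h.2.1 h.2.2)

noncomputable instance (n : ℕ) : Fintype (TetFlag n) := Fintype.ofFinite _

/-- For `v ≠ w`, `nextFace v w` is the vertex `a` such that `(v, w, a, b)` is an even ordering of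
the four vertices; then `b = nextFace w v`. (The value at `v = w` is irrelevant.)
The boundary triangle `(t, v)` is oriented by `w → a → b → w`. -/
def nextFace (v w : Fin 4) : Fin 4 :=
  (![![0, 2, 3, 1], ![3, 1, 0, 2], ![1, 3, 2, 0], ![2, 0, 1, 3]] : Fin 4 → Fin 4 → Fin 4) v w

/-- The three quadrilateral types of a tetrahedron are `0 = 01:23`, `1 = 02:13`, `2 = 03:12`;
`quadFacing v w` is the one facing the edge `vw`, i.e. disjoint from it. (The value at `v = w` is
irrelevant.) -/
def quadFacing (v w : Fin 4) : Fin 3 :=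
  (![![0, 0, 1, 2], ![0, 0, 2, 1], ![1, 2, 0, 0], ![2, 1, 0, 0]] : Fin 4 → Fin 4 → Fin 3) v w

lemma nextFace_props : ∀ v w : Fin 4, v ≠ w →
    nextFace v w ≠ v ∧ nextFace v w ≠ w ∧ nextFace v w ≠ nextFace w v ∧
    nextFace v (nextFace v w) = nextFace w v := by decide

lemma nextFace_even : ∀ σ : Equiv.Perm (Fin 4), Equiv.Perm.sign σ = 1 →
    nextFace (σ 0) (σ 1) = σ 2 := by decide

lemma nextFace_odd : ∀ g : Equiv.Perm (Fin 4), Equiv.Perm.sign g = -1 →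
    ∀ v w : Fin 4, v ≠ w → nextFace (g v) (g w) = g (nextFace w v) := by decide +kernel

namespace OrientedGluing

variable {n : ℕ} (T : OrientedGluing n)

/-- The image of an edge `vw` of `t` under the gluing of the face `f` of `t`
(used when `f ≠ v, w`). -/
def move (x : TetFlag n) (f : Fin 4) : TetFlag n :=
  ⟨T.nbr x.t f, T.glue x.t f x.v, T.glue x.t f x.w, fun h => x.ne ((T.glue x.t f).injective h)⟩

/-- Gluing of oriented edges (equivalently, of corners of boundary triangles). -/
def EndRel (x y : TetFlag n) : Prop := ∃ f, f ≠ x.v ∧ f ≠ x.w ∧ y = T.move x f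

/-- Oriented edges of the triangulation, i.e. ends of edges, i.e. vertices of the triangulated
boundary surface. -/
def EdgeEnd : Type := Quot T.EndRel

/-- Gluing of unoriented edges. -/
def EdgeRel (x y : TetFlag n) : Prop := T.EndRel x y ∨ (y.t = x.t ∧ y.v = x.w ∧ y.w = x.v)

/-- Edge classes of the triangulation. -/
def Edge : Type := Quot T.EdgeRel

/-- Gluing of vertices of tetrahedra. -/
def CuspRel (x y : Fin n × Fin 4) : Prop :=
  ∃ f, f ≠ x.2 ∧ y = (T.nbr x.1 f, T.glue x.1 f x.2)

/-- Ideal vertices, i.e. boundary components. -/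
def Cusp : Type := Quot T.CuspRel

def endOf (x : TetFlag n) : T.EdgeEnd := Quot.mk _ x
def edgeOf (x : TetFlag n) : T.Edge := Quot.mk _ x
def cuspOf (t : Fin n) (v : Fin 4) : T.Cusp := Quot.mk _ (t, v)

end OrientedGluing

/-- An oriented ideal triangulation (with `n` tetrahedra) of the interior of a compact oriented
3-manifold `M` whose boundary consists of tori. Truncating the ideal vertices gives `M`; its
boundary is tiled by the boundary triangles `(t, v)`, and a boundary component with `V` vertices and
`F` triangles has Euler characteristic `V - F / 2`. -/
structure IdealTriangulation (n : ℕ) extends OrientedGluing n where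
  torus : ∀ k : toOrientedGluing.Cusp,
    2 * Nat.card {e : toOrientedGluing.EdgeEnd //
        ∃ x : TetFlag n, toOrientedGluing.endOf x = e ∧ toOrientedGluing.cuspOf x.t x.v = k} =
      Nat.card {p : Fin n × Fin 4 // toOrientedGluing.cuspOf p.1 p.2 = k}

namespace IdealTriangulation

open Classical

variable {n : ℕ} (T : IdealTriangulation n)

/-! ## Q-normal classes -/

/-- The shear parameter along the edge `vw` of `t` caused by the quad coordinates `S`. For quad
coordinates `(a, b, c)` it is `c - b`, `a - c`, `b - a` along the edges facing the quads
`0`, `1`, `2`. -/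
def shear (S : Fin n → Fin 3 → ℤ) (x : TetFlag n) : ℤ :=
  S x.t (quadFacing x.v x.w + 2) - S x.t (quadFacing x.v x.w + 1)

/-- `Q(T; ℤ)`: integer quad coordinates satisfying the `Q`-matching equations, i.e. the shear
parameters add up to zero around every edge class. -/
def Q : Submodule ℤ (Fin n → Fin 3 → ℤ) where
  carrier := {S | ∀ e : T.Edge, ∑ x : TetFlag n with x.v < x.w ∧ T.edgeOf x = e, shear S x = 0}
  zero_mem' := by intro e; simp [shear]
  add_mem' := by
    intro S S' h h' e
    have := congrArg₂ (· + ·) (h e) (h' e)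
    simp only [← Finset.sum_add_distrib, add_zero] at this
    rw [← this]
    exact Finset.sum_congr rfl fun x _ => by simp only [shear, Pi.add_apply]; ring
  smul_mem' := by
    intro c S h e
    have := congrArg (c * ·) (h e)
    simp only [Finset.mul_sum, mul_zero] at this
    rw [← this]
    exact Finset.sum_congr rfl fun x _ => by
      simp only [shear, Pi.smul_apply, smul_eq_mul]; ring

/-- The edge solution `E_e`: the sum of all quads facing the edges in the class `e`. -/
noncomputable def edgeSol (e : T.Edge) : Fin n → Fin 3 → ℤ := fun t q =>
  ((Finset.univ.filter fun x : TetFlag n =>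
    x.v < x.w ∧ T.edgeOf x = e ∧ x.t = t ∧ quadFacing x.v x.w = q).card : ℤ)

/-- The tetrahedral solution of the tetrahedron `j`. -/
def tetSol (j : Fin n) : Fin n → Fin 3 → ℤ := fun t _ => if t = j then 1 else 0

/-- The subgroup of `Q(T; ℤ)` generated by the tetrahedral solutions. -/
def tetSub : Submodule ℤ T.Q :=
  (Submodule.span ℤ (Set.range (tetSol (n := n)))).comap T.Q.subtype

/-- The set `N(T; ℤ)` of closed normal classes: the integer quad coordinates `S` that, together
with suitable triangle coordinates, satisfy Haken's matching equations. There is one equation for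
each normal arc type of each face: the arc cutting off the vertex `v` in the face opposite
to `w` lies on the triangle at `v` and on the quad facing the edge `vw`. -/
def IsClosedClass (S : Fin n → Fin 3 → ℤ) : Prop :=
  ∃ tri : Fin n → Fin 4 → ℤ, ∀ x : TetFlag n,
    tri x.t x.v + S x.t (quadFacing x.v x.w) =
      tri (T.move x x.w).t (T.move x x.w).v +
        S (T.move x x.w).t (quadFacing (T.move x x.w).v (T.move x x.w).w)

/-- At most one quad type in each tetrahedron. -/
def IsEmbedded (S : Fin n → Fin 3 → ℤ) : Prop :=
  ∀ t q q', S t q ≠ 0 → S t q' ≠ 0 → q = q'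

/-- The double arc function. -/
def doubleArc (S : Fin n → Fin 3 → ℤ) : ℤ :=
  ∑ t, (S t 0 * S t 1 + S t 1 * S t 2 + S t 2 * S t 0)

/-- The symmetric bilinear form `δ(S, S')` associated with the double arc function, so that
`δ(S + S') = δ(S) + δ(S') + 2 δ(S, S')`. -/
def doubleArcBilin (S S' : Fin n → Fin 3 → ℤ) : ℚ :=
  1 / 2 * ∑ t, (((S t 0 * S' t 1 + S t 1 * S' t 2 + S t 2 * S' t 0) +
    (S' t 0 * S t 1 + S' t 1 * S t 2 + S' t 2 * S t 0) : ℤ) : ℚ)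

/-! ## The group `H₁(∂M; ℤ)`

Cellular homology of the boundary surface. A 1-chain is given by the coefficient `c x` of each
side `x` of each boundary triangle, the side being oriented as in the boundary of that triangle.
Each 1-cell is a side of two triangles, which induce opposite orientations. -/

/-- The cellular boundary of a 2-chain. -/
def bdry2 : (Fin n → Fin 4 → ℤ) →ₗ[ℤ] (TetFlag n → ℤ) where
  toFun y := fun x => y x.t x.v - y (T.move x x.w).t (T.move x x.w).v
  map_add' y y' := by ext x; simp only [Pi.add_apply]; ring
  map_smul' c y := by
    ext x; simp only [Pi.smul_apply, smul_eq_mul, RingHom.id_apply]; ring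

/-- 1-cycles. Around the vertex `e` of the boundary surface the corners `x` at `e` are separated by
the 1-cells ending at `e`; the side of a boundary triangle that ends at its corner `x` is the one
opposite to the corner `nextFace x.v x.w`. -/
def Z1 : Submodule ℤ (TetFlag n → ℤ) where
  carrier := {c | (∀ x, c (T.move x x.w) = - c x) ∧
    ∀ e : T.EdgeEnd, ∑ x : TetFlag n with T.endOf x = e,
      c ⟨x.t, x.v, nextFace x.v x.w, (nextFace_props _ _ x.ne).1.symm⟩ = 0}
  zero_mem' := by constructor <;> intros <;> simp
  add_mem' := by
    rintro c c' ⟨h1, h2⟩ ⟨h1', h2'⟩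
    refine ⟨fun x => by simp only [Pi.add_apply, h1, h1']; ring, fun e => ?_⟩
    simp only [Pi.add_apply, Finset.sum_add_distrib, h2, h2', add_zero]
  smul_mem' := by
    rintro k c ⟨h1, h2⟩
    refine ⟨fun x => by simp only [Pi.smul_apply, smul_eq_mul, h1]; ring, fun e => ?_⟩
    simp only [Pi.smul_apply, smul_eq_mul, ← Finset.mul_sum, h2, mul_zero]

/-- `H₁(∂M; ℤ)`: 1-cycles modulo boundaries. -/
abbrev H1 : Type := T.Z1 ⧸ (LinearMap.range T.bdry2).comap T.Z1.subtype

/-- The boundary chain of a linear combination of quads. Each quad is replaced by a twisted octagon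
with four external edges, one for each of its four normal arcs; the external edges, oriented from
the internal edges of shear `+1` to those of shear `-1`, are oriented as the boundaries of the
boundary triangles that contain them. -/
def bdryChain : (Fin n → Fin 3 → ℤ) →ₗ[ℤ] (TetFlag n → ℤ) where
  toFun S := fun x => S x.t (quadFacing x.v x.w) -
    S (T.move x x.w).t (quadFacing (T.move x x.w).v (T.move x x.w).w)
  map_add' y y' := by ext x; simp only [Pi.add_apply]; ring
  map_smul' c y := by
    ext x; simp only [Pi.smul_apply, smul_eq_mul, RingHom.id_apply]; ring

/-! ## The group `H₂(M, ∂M; ℤ/2)`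

Cellular homology of the truncated triangulation relative to its boundary: the relative cells are
the tetrahedra, the faces and the edges. A 2-chain is given by the coefficient `φ t f` of each face
`f` of each tetrahedron `t`; faces that are glued have the same coefficient. -/

/-- The relative cellular boundary of a 3-chain mod 2. -/
def bdry3 : (Fin n → ZMod 2) →ₗ[ℤ] (Fin n → Fin 4 → ZMod 2) where
  toFun y := fun t f => y t + y (T.nbr t f)
  map_add' y y' := by ext t f; simp only [Pi.add_apply]; ring
  map_smul' c y := by
    ext t f; simp only [Pi.smul_apply, smul_add, RingHom.id_apply]

/-- Relative 2-cycles mod 2. The faces at an edge, given as an oriented edge `e`, separate the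
tetrahedra around it; each of them is the face `nextFace x.v x.w` of exactly one tetrahedron edge
`x` in the class `e`. -/
def Z2 : Submodule ℤ (Fin n → Fin 4 → ZMod 2) where
  carrier := {φ | (∀ t f, φ (T.nbr t f) (T.glue t f f) = φ t f) ∧
    ∀ e : T.EdgeEnd, ∑ x : TetFlag n with T.endOf x = e, φ x.t (nextFace x.v x.w) = 0}
  zero_mem' := by constructor <;> intros <;> simp
  add_mem' := by
    rintro c c' ⟨h1, h2⟩ ⟨h1', h2'⟩
    refine ⟨fun t f => by simp only [Pi.add_apply, h1, h1'], fun e => ?_⟩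
    simp only [Pi.add_apply, Finset.sum_add_distrib, h2, h2', add_zero]
  smul_mem' := by
    rintro k c ⟨h1, h2⟩
    refine ⟨fun t f => by simp only [Pi.smul_apply, h1], fun e => ?_⟩
    simp only [Pi.smul_apply, ← Finset.smul_sum, h2, smul_zero]

/-- `H₂(M, ∂M; ℤ/2)`: relative 2-cycles modulo boundaries. -/
abbrev H2 : Type := T.Z2 ⧸ (LinearMap.range T.bdry3).comap T.Z2.subtype

/-- The contribution of the quads `S` of the tetrahedron `t` to its face `f`. The twisted octagon of
a quad type that faces the edges `e, e'` is homologous, relative to the boundary and within the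
truncated tetrahedron, to the sum of the two faces containing `e`, and to the sum of the two faces
containing `e'`; for the types `01:23`, `02:13`, `03:12` we use the two faces containing
`01`, `02`, `03`, which are the faces opposite to `2, 3`, to `1, 3` and to `1, 2`. -/
def octFace (S : Fin n → Fin 3 → ℤ) (t : Fin n) (f : Fin 4) : ZMod 2 :=
  ((![0, S t 1 + S t 2, S t 0 + S t 2, S t 0 + S t 1] : Fin 4 → ℤ) f : ℤ)

/-- The relative 2-chain mod 2 of a linear combination of quads (the coefficient of a face is the
sum of the contributions from its two sides). -/
def octChain : (Fin n → Fin 3 → ℤ) →ₗ[ℤ] (Fin n → Fin 4 → ZMod 2) where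
  toFun S := fun t f => octFace S t f + octFace S (T.nbr t f) (T.glue t f f)
  map_add' S S' := by
    have h : ∀ t f, octFace (S + S') t f = octFace S t f + octFace S' t f := by
      intro t f
      fin_cases f <;> simp [octFace] <;> ring
    ext t f; simp only [h, Pi.add_apply]; ring
  map_smul' c S := by
    have h : ∀ t f, octFace (c • S) t f = c • octFace S t f := by
      intro t f
      fin_cases f <;> simp [octFace]
    ext t f; simp only [h, Pi.smul_apply, smul_add, RingHom.id_apply]

/-! ## The homology classes of a Q-normal class -/

/-- The same tetrahedron edge with the opposite orientation. -/
def rev (x : TetFlag n) : TetFlag n := ⟨x.t, x.w, x.v, x.ne.symm⟩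

/-- Passing to the next tetrahedron around an oriented edge. -/
def rot (x : TetFlag n) : TetFlag n := T.move x (nextFace x.v x.w)

lemma rev_rev (x : TetFlag n) : rev (rev x) = x := rfl

lemma move_move (x : TetFlag n) (f : Fin 4) :
    T.move (T.move x f) (T.glue x.t f f) = x := by
  ext1
  · exact T.nbr_nbr _ _
  · simp [OrientedGluing.move, T.glue_glue]
  · simp [OrientedGluing.move, T.glue_glue]

lemma nextFace_rot (x : TetFlag n) :
    nextFace (T.rot x).w (T.rot x).v = T.glue x.t (nextFace x.v x.w) (nextFace x.v x.w) :=
  nextFace_odd _ (T.sign_glue _ _) _ _ x.ne.symm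

lemma rot_bijective : Function.Bijective T.rot := by
  apply Finite.injective_iff_bijective.1
  intro x y h
  have hx := T.move_move x (nextFace x.v x.w)
  have hy := T.move_move y (nextFace y.v y.w)
  rw [← T.nextFace_rot] at hx hy
  change T.move (T.rot x) _ = x at hx
  change T.move (T.rot y) _ = y at hy
  rw [← hx, ← hy, h]

lemma endOf_rot (x : TetFlag n) : T.endOf (T.rot x) = T.endOf x :=
  (Quot.sound ⟨_, (nextFace_props _ _ x.ne).1, (nextFace_props _ _ x.ne).2.1, rfl⟩).symm

lemma sum_rot {A : Type*} [AddCommMonoid A] (e : T.EdgeEnd) (F : TetFlag n → A) :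
    ∑ x : TetFlag n with T.endOf x = e, F (T.rot x) = ∑ x : TetFlag n with T.endOf x = e, F x := by
  rw [Finset.sum_filter, Finset.sum_filter,
    ← T.rot_bijective.sum_comp fun x => if T.endOf x = e then F x else 0]
  simp only [endOf_rot]

lemma endOf_rev {x y : TetFlag n} (h : T.endOf x = T.endOf y) :
    T.endOf (rev x) = T.endOf (rev y) := by
  have := Quot.eqvGen_exact h
  clear h
  induction this with
  | rel x y h =>
    obtain ⟨f, h1, h2, rfl⟩ := h
    exact Quot.sound ⟨f, h2, h1, rfl⟩
  | refl => rfl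
  | symm _ _ _ ih => exact ih.symm
  | trans _ _ _ _ _ ih1 ih2 => exact ih1.trans ih2

lemma edgeOf_eq_iff (x y : TetFlag n) : T.edgeOf x = T.edgeOf y ↔
    T.endOf x = T.endOf y ∨ T.endOf x = T.endOf (rev y) := by
  constructor
  · intro h
    have := Quot.eqvGen_exact h
    clear h
    induction this with
    | rel x y h =>
      rcases h with h | ⟨h1, h2, h3⟩
      · exact Or.inl (Quot.sound h)
      · right
        congr 1
        ext1
        · exact h1.symm
        · exact h3.symm
        · exact h2.symm
    | refl => exact Or.inl rfl
    | symm _ _ _ ih =>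
      rcases ih with h | h
      · exact Or.inl h.symm
      · exact Or.inr (T.endOf_rev h).symm
    | trans _ _ _ _ _ ih1 ih2 =>
      rcases ih1 with h | h <;> rcases ih2 with h' | h'
      · exact Or.inl (h.trans h')
      · exact Or.inr (h.trans h')
      · exact Or.inr (h.trans (T.endOf_rev h'))
      · exact Or.inl (h.trans (T.endOf_rev h'))
  · have key : ∀ x y : TetFlag n, T.endOf x = T.endOf y → T.edgeOf x = T.edgeOf y := by
      intro x y h
      have := Quot.eqvGen_exact h
      clear h
      induction this with
      | rel x y h => exact Quot.sound (Or.inl h)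
      | refl => rfl
      | symm _ _ _ ih => exact ih.symm
      | trans _ _ _ _ _ ih1 ih2 => exact ih1.trans ih2
    rintro (h | h)
    · exact key _ _ h
    · exact (key _ _ h).trans (Quot.sound (Or.inr ⟨rfl, rfl, rfl⟩))

lemma quadFacing_props : ∀ v w : Fin 4, v ≠ w → quadFacing w v = quadFacing v w ∧
    quadFacing v (nextFace v w) = quadFacing v w + 1 ∧
    quadFacing v (nextFace w v) = quadFacing v w + 2 := by decide

lemma shear_rev (S : Fin n → Fin 3 → ℤ) (x : TetFlag n) : shear S (rev x) = shear S x := by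
  simp only [shear, rev, (quadFacing_props _ _ x.ne).1]

lemma rev_bijective : Function.Bijective (rev (n := n)) :=
  Function.Involutive.bijective rev_rev

/-- The `Q`-matching equations, summed over an oriented edge class. -/
lemma sum_shear_end (S : T.Q) (e : T.EdgeEnd) :
    ∑ x : TetFlag n with T.endOf x = e, shear S.1 x = 0 := by
  obtain ⟨x₀, rfl⟩ := Quot.exists_rep e
  change ∑ x : TetFlag n with T.endOf x = T.endOf x₀, shear S.1 x = 0
  have h1 := S.2 (T.edgeOf x₀)
  have h2 : ∑ x : TetFlag n with T.edgeOf x = T.edgeOf x₀, shear S.1 x = 0 := by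
    have hrev : ∀ x, T.edgeOf (rev x) = T.edgeOf x := fun x =>
      (Quot.sound (r := T.EdgeRel) (a := x) (b := rev x) (Or.inr ⟨rfl, rfl, rfl⟩)).symm
    have h3 : ∑ x : TetFlag n with x.w < x.v ∧ T.edgeOf x = T.edgeOf x₀, shear S.1 x = 0 := by
      rw [← h1, Finset.sum_filter, Finset.sum_filter, ← rev_bijective.sum_comp]
      simp only [shear_rev, hrev]
      rfl
    have h4 : ∀ x : TetFlag n, (if T.edgeOf x = T.edgeOf x₀ then shear S.1 x else 0) =
        (if x.v < x.w ∧ T.edgeOf x = T.edgeOf x₀ then shear S.1 x else 0) +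
        (if x.w < x.v ∧ T.edgeOf x = T.edgeOf x₀ then shear S.1 x else 0) := by
      intro x
      rcases lt_or_gt_of_ne x.ne with h | h
      · simp [h, h.not_gt]
      · simp [h, h.not_gt]
    rw [Finset.sum_filter, Finset.sum_congr rfl fun x _ => h4 x, Finset.sum_add_distrib,
      ← Finset.sum_filter, ← Finset.sum_filter, h3, h1, add_zero]
  by_cases he : T.endOf x₀ = T.endOf (rev x₀)
  · rw [← h2]
    refine Finset.sum_congr (Finset.filter_congr fun x _ => ?_) fun _ _ => rfl
    rw [edgeOf_eq_iff, ← he, or_self]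
  · have h3 : ∑ x : TetFlag n with T.endOf x = T.endOf (rev x₀), shear S.1 x =
        ∑ x : TetFlag n with T.endOf x = T.endOf x₀, shear S.1 x := by
      rw [Finset.sum_filter, Finset.sum_filter, ← rev_bijective.sum_comp]
      refine Finset.sum_congr rfl fun x _ => ?_
      have : T.endOf (rev x) = T.endOf (rev x₀) ↔ T.endOf x = T.endOf x₀ :=
        ⟨fun h => T.endOf_rev h, fun h => T.endOf_rev h⟩
      simp only [shear_rev, this]
    have h4 : ∀ x : TetFlag n, (if T.edgeOf x = T.edgeOf x₀ then shear S.1 x else 0) =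
        (if T.endOf x = T.endOf x₀ then shear S.1 x else 0) +
        (if T.endOf x = T.endOf (rev x₀) then shear S.1 x else 0) := by
      intro x
      rw [edgeOf_eq_iff]
      by_cases h : T.endOf x = T.endOf x₀
      · simp [h, he]
      · simp [h]
    rw [Finset.sum_filter, Finset.sum_congr rfl fun x _ => h4 x, Finset.sum_add_distrib,
      ← Finset.sum_filter, ← Finset.sum_filter, h3] at h2
    omega

lemma bdryChain_mem (S : T.Q) : T.bdryChain S.1 ∈ T.Z1 := by
  constructor
  · intro x
    have h := T.move_move x x.w
    change T.move (T.move x x.w) (T.move x x.w).w = x at h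
    simp only [bdryChain, LinearMap.coe_mk, AddHom.coe_mk]
    rw [h]
    ring
  · intro e
    have h : ∀ x : TetFlag n,
        T.bdryChain S.1 ⟨x.t, x.v, nextFace x.v x.w, (nextFace_props _ _ x.ne).1.symm⟩ =
          S.1 x.t (quadFacing x.v x.w + 1) -
            S.1 (T.rot x).t (quadFacing (T.rot x).v (T.rot x).w + 2) := by
      intro x
      rw [← (quadFacing_props _ _ x.ne).2.1, ← (quadFacing_props _ _ (T.rot x).ne).2.2,
        T.nextFace_rot]
      rfl
    rw [Finset.sum_congr rfl fun x _ => h x, Finset.sum_sub_distrib,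
      T.sum_rot e fun x => S.1 x.t (quadFacing x.v x.w + 2), ← Finset.sum_sub_distrib,
      ← neg_eq_zero, ← Finset.sum_neg_distrib, ← T.sum_shear_end S e]
    exact Finset.sum_congr rfl fun x _ => by simp only [shear]; ring

/-- The boundary `S ↦ [∂S] ∈ H₁(∂M; ℤ)`. -/
def bdryClass : T.Q →ₗ[ℤ] T.H1 :=
  Submodule.mkQ _ ∘ₗ LinearMap.codRestrict T.Z1 (T.bdryChain ∘ₗ T.Q.subtype) T.bdryChain_mem

lemma octFace_shear (S : Fin n → Fin 3 → ℤ) (t : Fin n) : ∀ v w : Fin 4, v ≠ w →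
    octFace S t (nextFace v w) + octFace S t (nextFace w v) =
      ((S t (quadFacing v w + 2) - S t (quadFacing v w + 1) : ℤ) : ZMod 2) := by
  have h : ∀ x : ZMod 2, x + x = 0 := by decide
  have h' : ∀ x y : ZMod 2, x - y = x + y := by decide
  intro v w hvw
  fin_cases v <;> fin_cases w <;> first
    | exact absurd rfl hvw
    | (simp [octFace, nextFace, quadFacing, h']
       try grind)

lemma octChain_mem (S : T.Q) : T.octChain S.1 ∈ T.Z2 := by
  constructor
  · intro t f
    have h : (T.glue t f)⁻¹ (T.glue t f f) = f := (T.glue t f).symm_apply_apply f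
    simp only [octChain, LinearMap.coe_mk, AddHom.coe_mk, T.nbr_nbr, T.glue_glue, h]
    rw [add_comm]
  · intro e
    have h : ∀ x : TetFlag n, T.octChain S.1 x.t (nextFace x.v x.w) =
        octFace S.1 x.t (nextFace x.v x.w) +
          octFace S.1 (T.rot x).t (nextFace (T.rot x).w (T.rot x).v) := by
      intro x
      rw [T.nextFace_rot]
      rfl
    rw [Finset.sum_congr rfl fun x _ => h x, Finset.sum_add_distrib,
      T.sum_rot e fun x => octFace S.1 x.t (nextFace x.w x.v), ← Finset.sum_add_distrib,
      Finset.sum_congr rfl fun x _ => octFace_shear S.1 x.t x.v x.w x.ne]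
    have := congrArg (Int.cast : ℤ → ZMod 2) (T.sum_shear_end S e)
    simpa [shear] using this

/-- The mod 2 homology class `S ↦ [S]₂ ∈ H₂(M, ∂M; ℤ/2)`. -/
def mod2Class : T.Q →ₗ[ℤ] T.H2 :=
  Submodule.mkQ _ ∘ₗ LinearMap.codRestrict T.Z2 (T.octChain ∘ₗ T.Q.subtype) T.octChain_mem

lemma tetSub_le_ker : T.tetSub ≤ LinearMap.ker (T.mod2Class.prod T.bdryClass) := by
  intro S hS
  have h1 : T.bdryChain S.1 ∈ LinearMap.range T.bdry2 := by
    have : Submodule.span ℤ (Set.range (tetSol (n := n))) ≤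
        (LinearMap.range T.bdry2).comap T.bdryChain := by
      rw [Submodule.span_le]
      rintro _ ⟨j, rfl⟩
      exact ⟨fun t _ => if t = j then 1 else 0, rfl⟩
    exact this hS
  have h2 : T.octChain S.1 ∈ LinearMap.range T.bdry3 := by
    have : Submodule.span ℤ (Set.range (tetSol (n := n))) ≤
        (LinearMap.range T.bdry3).comap T.octChain := by
      rw [Submodule.span_le]
      rintro _ ⟨j, rfl⟩
      have h : ∀ t f, octFace (tetSol j) t f = 0 := by
        intro t f
        have h2 : ∀ x : ZMod 2, x + x = 0 := by decide
        fin_cases f <;> simp [octFace, tetSol, h2]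
      exact ⟨0, by ext t f; simp [octChain, h]⟩
    exact this hS
  rw [LinearMap.mem_ker]
  refine Prod.ext ?_ ?_
  exacts [(Submodule.Quotient.mk_eq_zero _).2 h2, (Submodule.Quotient.mk_eq_zero _).2 h1]

/-- The homomorphism `h : Q(T; ℤ) / 𝕋 → H₂(M, ∂M; ℤ/2) × H₁(∂M; ℤ)`, `[S] ↦ ([S]₂, [∂S])`, where
`𝕋` is the subgroup generated by the tetrahedral solutions. -/
def homClass : T.Q ⧸ T.tetSub →ₗ[ℤ] T.H2 × T.H1 :=
  T.tetSub.liftQ (T.mod2Class.prod T.bdryClass) T.tetSub_le_ker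

/-! ## Peripheral curves and the formal Euler characteristic -/

/-- An oriented simple closed normal curve on the boundary surface, given as a cyclic sequence of
normal arcs in boundary triangles, each triangle being visited at most once. The arc `i` runs in the
boundary triangle `((arc i).t, (arc i).v)` and winds around its corner `(arc i).w`, in the positive
direction of the oriented triangle if `pos i`, and in the negative direction otherwise.
(The homology classes of these curves span `H₁(∂M; ℝ)`.) -/
structure NormalCurve where
  len : ℕ
  arc : Fin (len + 1) → TetFlag n
  pos : Fin (len + 1) → Bool
  simple : Function.Injective fun i => ((arc i).t, (arc i).v)
  /-- The side through which an arc leaves its triangle is glued to the side through which the next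
  arc enters the next triangle. (A side of the triangle `(t, v)` lies in a face of `t`.) -/
  glued : ∀ i,
    let x := arc i
    let y := arc (i + 1)
    let leave := if pos i then nextFace x.v x.w else nextFace x.w x.v
    let enter := if pos (i + 1) then nextFace y.w y.v else nextFace y.v y.w
    y.t = T.nbr x.t leave ∧ y.v = T.glue x.t leave x.v ∧ enter = T.glue x.t leave leave

/-- A 1-cycle homologous to the curve `γ`: each arc that winds around its corner `w` in the positive
direction is pushed across the triangle to the side opposite to `w`, each other arc is pushed into
its corner `w`. -/
noncomputable def NormalCurve.chain {T : IdealTriangulation n} (γ : T.NormalCurve) :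
    TetFlag n → ℤ := fun x =>
  ∑ i, if γ.pos i then
    (if x = γ.arc i then 1 else 0) - (if x = T.move (γ.arc i) (γ.arc i).w then 1 else 0) else 0

/-- `γ` is not null-homologous; for a simple closed curve on a torus this means that it is not
contractible. -/
def NormalCurve.Essential {T : IdealTriangulation n} (γ : T.NormalCurve) : Prop :=
  γ.chain ∉ LinearMap.range T.bdry2

/-- The peripheral curve solution of `γ`: the sum of the quads facing the edges around which the
arcs of `γ` wind, with signs according to the direction. -/
noncomputable def NormalCurve.sol {T : IdealTriangulation n} (γ : T.NormalCurve) :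
    Fin n → Fin 3 → ℤ := fun t q =>
  ∑ i, if (γ.arc i).t = t ∧ quadFacing (γ.arc i).v (γ.arc i).w = q then
    (if γ.pos i then 1 else -1) else 0

/-- The values of the formal Euler characteristic on the edge solutions, the tetrahedral solutions
and the peripheral curve solutions. -/
structure IsFormalEuler (χ : T.Q →ₗ[ℤ] ℤ) : Prop where
  edge : ∀ (S : T.Q) (e : T.Edge), S.1 = T.edgeSol e → χ S = -2
  tet : ∀ (S : T.Q) (j : Fin n), S.1 = tetSol j → χ S = -1
  curve : ∀ (S : T.Q) (γ : T.NormalCurve), γ.Essential → S.1 = γ.sol → χ S = 0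

/-- The formal Euler characteristic `χ`, i.e. the linear map with
`χ(∑ xᵢ Eᵢ + ∑ yⱼ Tⱼ + peripheral curve solutions) = ∑ -2 xᵢ - ∑ yⱼ`. It exists, and it is
unique since the edge, tetrahedral and peripheral curve solutions span `Q(T; ℤ)` over the reals. -/
noncomputable def eulerChar : T.Q →ₗ[ℤ] ℤ :=
  if h : ∃ χ : T.Q →ₗ[ℤ] ℤ, T.IsFormalEuler χ then h.choose else 0

end IdealTriangulation

/-! ## The tetrahedral index -/

namespace TetIndex

/-! The variable of the Laurent series ring `ℤ⸨X⸩` is `X = q^{1/2}`. -/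

/-- `1 / (q)_n`, where `(q)_n = ∏_{i = 1}^n (1 - q^i)`. -/
noncomputable def pochInv (n : ℕ) : PowerSeries ℤ :=
  PowerSeries.invOfUnit (∏ i ∈ Finset.range n, (1 - (PowerSeries.X : PowerSeries ℤ) ^ (2 * (i + 1)))) 1

/-- `(-1)^n q^{n(n+1)/2 - (n + e/2) m} / ((q)_n (q)_{n+e})`, for `n ≥ max(0, -e)`. -/
noncomputable def term (m e : ℤ) (n : ℕ) : ℤ⸨X⸩ :=
  if 0 ≤ (n : ℤ) + e then
    HahnSeries.single ((n : ℤ) * (n + 1) - (2 * n + e) * m) ((-1) ^ n) *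
      ((pochInv n * pochInv ((n : ℤ) + e).toNat : PowerSeries ℤ) : ℤ⸨X⸩)
  else 0

lemma le_of_coeff_term_ne (m e : ℤ) (n : ℕ) (k : ℤ) (h : (term m e n).coeff k ≠ 0) :
    (n : ℤ) * (n + 1) - (2 * n + e) * m ≤ k := by
  by_contra hk
  apply h
  rw [term]
  split_ifs
  · rw [HahnSeries.coeff_single_mul, PowerSeries.coeff_coe, if_pos (by omega), mul_zero]
  · rfl

lemma le_of_coeff_term_ne' (m e : ℤ) (n : ℕ) (k : ℤ) (h : (term m e n).coeff k ≠ 0) :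
    (n : ℤ) - m ^ 2 - e * m ≤ k := by
  have := le_of_coeff_term_ne m e n k h
  nlinarith [sq_nonneg ((n : ℤ) - m)]

/-- The terms of the tetrahedral index form a summable family of Laurent series. -/
noncomputable def family (m e : ℤ) : HahnSeries.SummableFamily ℤ ℤ ℕ where
  toFun := term m e
  isPWO_iUnion_support' := by
    refine (BddBelow.isWF ⟨- m ^ 2 - e * m, fun k hk => ?_⟩).isPWO
    obtain ⟨n, hn⟩ := Set.mem_iUnion.1 hk
    have := le_of_coeff_term_ne' m e n k hn
    have : (0 : ℤ) ≤ n := Int.natCast_nonneg n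
    linarith
  finite_co_support' := by
    intro k
    refine (Set.finite_Iic (k + m ^ 2 + e * m).toNat).subset fun n hn => ?_
    have := le_of_coeff_term_ne' m e n k hn
    rw [Set.mem_Iic]
    omega

/-- The tetrahedral index `I_Δ(m, e)`. -/
noncomputable def IΔ (m e : ℤ) : ℤ⸨X⸩ := (family m e).hsum

/-- `(-q^{1/2})^k`. -/
noncomputable def negX (k : ℤ) : ℤ⸨X⸩ := HahnSeries.single k (k.negOnePow : ℤ)

/-- The symmetric version `J_Δ(a, b, c)` of the tetrahedral index. -/
noncomputable def JΔ (a b c : ℤ) : ℤ⸨X⸩ := negX (-b) * IΔ (b - c) (a - b)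

end TetIndex

/-- The (unordered) sum of the Laurent series `f i` converges to `L` in the `X`-adic topology,
i.e. up to any given degree all sufficiently large finite partial sums agree with `L`. -/
def HasLaurentSum {ι : Type*} (f : ι → ℤ⸨X⸩) (L : ℤ⸨X⸩) : Prop :=
  ∀ D : ℤ, ∃ s₀ : Finset ι, ∀ s : Finset ι, s₀ ⊆ s → ∀ k ≤ D, (∑ i ∈ s, f i).coeff k = L.coeff k

/-! ## The 3D-index -/

namespace IdealTriangulation

variable {n : ℕ} (T : IdealTriangulation n)

/-- `I(S) = (-q^{1/2})^{-χ(S)} ∏_j J_Δ(a_j, b_j, c_j)`. -/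
noncomputable def surfaceIndex (S : T.Q) : ℤ⸨X⸩ :=
  TetIndex.negX (- T.eulerChar S) * ∏ j, TetIndex.JΔ (S.1 j 0) (S.1 j 1) (S.1 j 2)

/-- The representative of the class of `S` modulo tetrahedral solutions that has minimal
non-negative coordinates: the smallest of the three quad coordinates is subtracted in each
tetrahedron. -/
def minFun (S : Fin n → Fin 3 → ℤ) : Fin n → Fin 3 → ℤ :=
  fun t q => S t q - min (S t 0) (min (S t 1) (S t 2))

lemma minFun_mem (S : T.Q) : minFun S.1 ∈ T.Q := by
  intro e
  rw [← S.2 e]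
  exact Finset.sum_congr rfl fun x _ => by simp only [shear, minFun]; ring

def minRep (S : T.Q) : T.Q := ⟨minFun S.1, T.minFun_mem S⟩

lemma minRep_eq (S S' : T.Q) (h : S - S' ∈ T.tetSub) : T.minRep S = T.minRep S' := by
  have key : ∀ U ∈ Submodule.span ℤ (Set.range (tetSol (n := n))), ∃ m : Fin n → ℤ,
      ∀ t q, U t q = m t := by
    intro U hU
    induction hU using Submodule.span_induction with
    | mem x hx =>
      obtain ⟨j, rfl⟩ := hx
      exact ⟨fun t => if t = j then 1 else 0, fun _ _ => rfl⟩
    | zero => exact ⟨0, fun _ _ => rfl⟩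
    | add x y _ _ hx hy =>
      obtain ⟨m, hm⟩ := hx
      obtain ⟨m', hm'⟩ := hy
      exact ⟨m + m', fun t q => by simp [hm, hm']⟩
    | smul c x _ hx =>
      obtain ⟨m, hm⟩ := hx
      exact ⟨c • m, fun t q => by simp [hm]⟩
  obtain ⟨m, hm⟩ := key _ h
  have hm' : ∀ t q, S.1 t q = S'.1 t q + m t := by
    intro t q
    have := hm t q
    simp only [Submodule.subtype_apply, Submodule.coe_sub, Pi.sub_apply] at this
    linarith
  apply Subtype.ext
  funext t q
  simp only [minRep, minFun, hm', min_add_add_right]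
  ring

/-- The function `I : Q(T; ℤ) / 𝕋 → ℤ((q^{1/2}))` induced by `surfaceIndex`. (Adding tetrahedral
solutions to `S` does not change `I(S)`; we evaluate `I` at the minimal non-negative
representative.) -/
noncomputable def classIndex (c : T.Q ⧸ T.tetSub) : ℤ⸨X⸩ :=
  Quotient.liftOn' c (fun S => T.surfaceIndex (T.minRep S)) fun S S' h => by
    rw [T.minRep_eq S S' ((Submodule.quotientRel_def _).1 h)]

/-- The index sum `I_T^a(b) = ∑ I([S])`, over all classes `[S]` of `Q`-normal classes modulo
tetrahedral solutions with `[S]₂ = a` and `[∂S] = b`, converges as a formal Laurent series. -/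
def IndexSumConverges (a : T.H2) (b : T.H1) : Prop :=
  ∃ L : ℤ⸨X⸩, HasLaurentSum (fun c : {c // T.homClass c = (a, b)} => T.classIndex c.1) L

end IdealTriangulation

/-! Each class modulo tetrahedral solutions is represented by the non-negative `S` whose minimum is
zero in every tetrahedron. For such `S` the order of `I(S)` in `q^{1/2}` is at least `-χ(S) + δ(S)`,
where `δ(S)` is `doubleArc S`; this is `indexDegree_le_orderTop`. It therefore suffices that only
finitely many non-negative `S` with `[∂S] = b` satisfy `-χ(S) + δ(S) ≤ D`, for every `D`; this is
`finite_indexDegree_le`.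

The order bound reduces to `le_orderTop_JΔ`: `J_Δ(a, b, c)` has order at least `ab + bc + ca` when
the minimum is zero. If `a = 0` or `b = 0`, every term of the defining series obeys the bound. If `c
= 0`, terms of lower order may cancel, and the symmetry `IΔ_symm`, obtained from two three-term
recursions, reduces this to the case `b = 0`.

For the finiteness, Dickson's lemma gives finitely many minimal non-negative solutions `S₀` with
boundary class `b`, and Gordan's lemma gives finitely many generators `g ≠ 0` of the monoid of
non-negative solutions with zero boundary class. Hence `S = S₀ + ∑ c_g g`. The pairings between
generators are non-negative, so the degree of `S` is at least that of `S₀` plus a sum of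
one-variable quadratics `c_g (-χ(g) + 2δ(S₀, g)) + c_g² δ(g)`. If `δ(g) > 0`, the quadratic term
dominates. If `δ(g) = 0`, then `g` is an embedded closed normal class and the hypothesis makes the
linear coefficient positive. In both cases a bound on the degree bounds `c_g`. Of `χ` only linearity
is used. -/

/-! ## Recursions, symmetry and degree of the tetrahedral index -/

namespace TetIndex

open HahnSeries

/-- `(q)_n` in the variable `X = q^{1/2}`. -/
noncomputable def poch (n : ℕ) : PowerSeries ℤ :=
  ∏ i ∈ Finset.range n, (1 - (PowerSeries.X : PowerSeries ℤ) ^ (2 * (i + 1)))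

lemma poch_mul_pochInv (n : ℕ) : poch n * pochInv n = 1 := by
  refine PowerSeries.mul_invOfUnit _ 1 ?_
  simp [poch, map_prod]

lemma pochInv_mul_succ (n : ℕ) :
    pochInv n = (1 - (PowerSeries.X : PowerSeries ℤ) ^ (2 * (n + 1))) * pochInv (n + 1) := by
  have h0 := poch_mul_pochInv n
  have h1 := poch_mul_pochInv (n + 1)
  have h2 : poch (n + 1) = poch n * (1 - PowerSeries.X ^ (2 * (n + 1))) :=
    Finset.prod_range_succ _ _
  rw [h2] at h1
  calc pochInv n = pochInv n * (poch n * (1 - PowerSeries.X ^ (2 * (n + 1))) *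
        pochInv (n + 1)) := by rw [h1, mul_one]
    _ = (poch n * pochInv n) * ((1 - PowerSeries.X ^ (2 * (n + 1))) * pochInv (n + 1)) := by ring
    _ = _ := by rw [h0, one_mul]

/-- `1 / (q)_k` for `k ∈ ℤ`, with the convention that it vanishes for `k < 0`. -/
noncomputable def pochInvZ (k : ℤ) : ℤ⸨X⸩ := if 0 ≤ k then (pochInv k.toNat : ℤ⸨X⸩) else 0

lemma pochInvZ_of_neg {k : ℤ} (hk : k < 0) : pochInvZ k = 0 := if_neg (by omega)

lemma coe_X_pow (m : ℕ) :
    (((PowerSeries.X : PowerSeries ℤ) ^ m : PowerSeries ℤ) : ℤ⸨X⸩) = single (m : ℤ) 1 := by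
  rw [PowerSeries.coe_pow, PowerSeries.coe_X, single_pow]
  simp

/-- This is `1/(q)_{k-1} = (1 - q^k)/(q)_k`. With the value zero at negative indices it holds for
all integers, since `1 - q^0 = 0`; this spares the recursions any treatment of the summation range.
-/
lemma pochInvZ_sub_one (k : ℤ) :
    pochInvZ (k - 1) = pochInvZ k - single (2 * k) 1 * pochInvZ k := by
  rcases lt_trichotomy k 0 with hk | rfl | hk
  · rw [pochInvZ_of_neg hk, pochInvZ_of_neg (by omega)]
    simp
  · rw [pochInvZ_of_neg (by omega)]
    simp
  · obtain ⟨j, rfl⟩ : ∃ j : ℕ, k = j + 1 := ⟨(k - 1).toNat, by omega⟩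
    have h1 : pochInvZ ((j : ℤ) + 1 - 1) = (pochInv j : ℤ⸨X⸩) := by
      simp [pochInvZ]
    have h2 : pochInvZ ((j : ℤ) + 1) = (pochInv (j + 1) : ℤ⸨X⸩) := by
      rw [pochInvZ, if_pos (by omega)]
      rfl
    rw [h1, h2, pochInv_mul_succ, PowerSeries.coe_mul, PowerSeries.coe_sub, PowerSeries.coe_one,
      coe_X_pow, sub_mul, one_mul]
    push_cast
    rfl

lemma term_eq (m e : ℤ) (n : ℕ) : term m e n =
    single ((n : ℤ) * (n + 1) - (2 * n + e) * m) ((-1 : ℤ) ^ n) *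
      (pochInvZ n * pochInvZ (n + e)) := by
  rw [term]
  split_ifs with h
  · rw [pochInvZ, pochInvZ, if_pos h, if_pos (by omega), PowerSeries.coe_mul]
    rfl
  · rw [pochInvZ_of_neg (by omega : (n : ℤ) + e < 0), mul_zero, mul_zero]

lemma family_apply (m e : ℤ) (n : ℕ) : family m e n = term m e n := rfl

lemma smul_family_apply {α : Type*} (x : ℤ⸨X⸩) (s : SummableFamily ℤ ℤ α) (i : α) :
    (x • s) i = x * s i := by
  rw [SummableFamily.smul_apply, of_symm_smul_of_eq_mul]

/-! ### Three-term recursions of the tetrahedral index -/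

/-- Termwise: relative to the `n`-th term on the left, the two terms on the right carry the factors
`q^{n+e}` and `1 - q^{n+e}`. -/
lemma IΔ_eq_sub_one (m e : ℤ) :
    IΔ m e = single e 1 * IΔ (m - 1) e + single (-m) 1 * IΔ m (e - 1) := by
  rw [IΔ, IΔ, IΔ, ← SummableFamily.hsum_smul, ← SummableFamily.hsum_smul,
    ← SummableFamily.hsum_add]
  congr 1
  ext1 n
  rw [SummableFamily.add_apply, smul_family_apply, smul_family_apply]
  simp only [family_apply, term_eq, ← mul_assoc, single_mul_single, one_mul]
  rw [show (n : ℤ) + (e - 1) = n + e - 1 by ring, pochInvZ_sub_one,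
    show e + ((n : ℤ) * (n + 1) - (2 * n + e) * (m - 1)) =
      (n : ℤ) * (n + 1) - (2 * n + e) * m + 2 * (n + e) by ring,
    show -m + ((n : ℤ) * (n + 1) - (2 * n + (e - 1)) * m) =
      (n : ℤ) * (n + 1) - (2 * n + e) * m by ring]
  have : single ((n : ℤ) * (n + 1) - (2 * n + e) * m + 2 * (n + e)) ((-1 : ℤ) ^ n) =
      single ((n : ℤ) * (n + 1) - (2 * n + e) * m) ((-1 : ℤ) ^ n) * single (2 * (n + e)) 1 := by
    rw [single_mul_single, mul_one]
  rw [this]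
  ring

/-- Relative to the `n`-th term on the left, the first series contributes the factor `q^{-n}`, and
the term of index `n - 1` of the second contributes `-q^{-n}(1 - q^n)`. The second series is
therefore reindexed by the successor map. -/
lemma IΔ_eq_add_one (m e : ℤ) :
    IΔ m e = single e 1 * IΔ (m + 1) e + single (-m) 1 * IΔ m (e + 1) := by
  have hsucc : (IΔ m (e + 1)) =
      ((family m (e + 1)).embDomain ⟨Nat.succ, Nat.succ_injective⟩).hsum :=
    (SummableFamily.hsum_embDomain _ _).symm
  rw [hsucc, IΔ, IΔ, ← SummableFamily.hsum_smul, ← SummableFamily.hsum_smul,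
    ← SummableFamily.hsum_add]
  congr 1
  ext1 n
  rw [SummableFamily.add_apply, smul_family_apply, smul_family_apply]
  cases n with
  | zero =>
    -- The shifted series has no term at `0`, and there the factor `q^{-n}` is `1`.
    rw [SummableFamily.embDomain_of_notMem_range _ _ (by simp)]
    simp only [family_apply, term_eq, ← mul_assoc, single_mul_single, one_mul]
    rw [mul_zero, add_zero]
    congr 3
    push_cast
    ring_nf
  | succ n =>
    have h := SummableFamily.embDomain_image (family m (e + 1))
      ⟨Nat.succ, Nat.succ_injective⟩ (a := n)
    change _ = _ + _ * ((family m (e + 1)).embDomain ⟨Nat.succ, Nat.succ_injective⟩)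
      ((⟨Nat.succ, Nat.succ_injective⟩ : ℕ ↪ ℕ) n)
    rw [h]
    simp only [family_apply, term_eq, ← mul_assoc, single_mul_single, one_mul]
    have h1 := pochInvZ_sub_one ((n : ℤ) + 1)
    rw [add_sub_cancel_right] at h1
    push_cast
    rw [show (n : ℤ) + (e + 1) = n + 1 + e by ring, h1]
    have h2 : single (-m + ((n : ℤ) * (n + 1) - (2 * n + (e + 1)) * m)) ((-1 : ℤ) ^ n) =
        - single (e + (((n : ℤ) + 1) * (n + 1 + 1) - (2 * (n + 1) + e) * (m + 1)))
          ((-1 : ℤ) ^ (n + 1)) := by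
      rw [pow_succ, mul_neg_one, single_neg, neg_neg]
      ring_nf
    have h3 : single (((n : ℤ) + 1) * (n + 1 + 1) - (2 * (n + 1) + e) * m)
          ((-1 : ℤ) ^ (n + 1)) =
        single (e + (((n : ℤ) + 1) * (n + 1 + 1) - (2 * (n + 1) + e) * (m + 1)))
          ((-1 : ℤ) ^ (n + 1)) * single (2 * ((n : ℤ) + 1)) 1 := by
      rw [single_mul_single, mul_one]
      ring_nf
    rw [h2, h3]
    ring

/-! ### Powers of `-q^{1/2}` and triality -/

lemma negX_mul (k l : ℤ) : negX k * negX l = negX (k + l) := by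
  rw [negX, negX, negX, single_mul_single, Int.negOnePow_add]
  rfl

lemma negX_zero : negX 0 = 1 := by
  simp [negX]

lemma negX_natCast (k : ℕ) : negX k = single (k : ℤ) ((-1 : ℤ) ^ k) := by
  rw [negX, Int.negOnePow_def]
  simp

lemma negX_succ (k : ℤ) : negX (k + 1) = - (single 1 1 * negX k) := by
  rw [negX, negX, single_mul_single, Int.negOnePow_succ, one_mul, add_comm 1 k]
  simp

/-- The terms with `n < b` vanish, and the substitution `n = k + b` exchanges the two denominators.
This starts the induction for `IΔ_symm`. -/
lemma IΔ_neg_self (b : ℕ) : IΔ b (-b) = negX b * IΔ 0 b := by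
  have hadd : IΔ 0 b = ((family 0 b).embDomain (addRightEmbedding b)).hsum :=
    (SummableFamily.hsum_embDomain _ _).symm
  rw [hadd, IΔ, ← SummableFamily.hsum_smul]
  congr 1
  ext1 n
  rw [smul_family_apply]
  by_cases hn : b ≤ n
  · obtain ⟨k, rfl⟩ : ∃ k, n = k + b := ⟨n - b, by omega⟩
    have h := SummableFamily.embDomain_image (family 0 b) (addRightEmbedding b) (a := k)
    rw [addRightEmbedding_apply] at h
    rw [h, negX_natCast]
    simp only [family_apply, term_eq, ← mul_assoc, single_mul_single]
    push_cast
    rw [show (k : ℤ) + b + -b = k by ring, mul_assoc, mul_assoc, mul_comm (pochInvZ ((k : ℤ) + b)),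
      show ((k : ℤ) + b) * (k + b + 1) - (2 * (k + b) + -b) * b =
        b + (k * (k + 1) - (2 * k + b) * 0) by ring, _root_.pow_add, mul_comm ((-1 : ℤ) ^ k)]
  · rw [SummableFamily.embDomain_of_notMem_range, family_apply, term_eq,
      pochInvZ_of_neg (by omega : (n : ℤ) + -b < 0), mul_zero, mul_zero, mul_zero]
    rintro ⟨k, hk⟩
    rw [addRightEmbedding_apply] at hk
    omega

lemma single_mul_cancel (k : ℤ) : (single k 1 * single (-k) 1 : ℤ⸨X⸩) = 1 := by
  rw [single_mul_single, add_neg_cancel, mul_one]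
  rfl

/-- An instance of the triality of the tetrahedral index: `J_Δ(a, b, 0) = J_Δ(b, 0, a)`. -/
lemma IΔ_symm (a b : ℕ) : IΔ b (a - b) = negX b * IΔ (-a) b := by
  -- The step to `a + 1` at `b` uses the identity for `a` at both `b` and `b + 1`: the recursions
  -- express each side through these values, the auxiliary `IΔ (b + 1) (a - b)` being eliminated by
  -- `r2`.
  induction a generalizing b with
  | zero => simpa using IΔ_neg_self b
  | succ a ih =>
    have r1 := IΔ_eq_add_one (b : ℤ) ((a : ℤ) - b)
    have r2 := IΔ_eq_sub_one ((b : ℤ) + 1) ((a : ℤ) - b)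
    have s1 := IΔ_eq_add_one (-((a : ℤ) + 1)) b
    have s2 := IΔ_eq_sub_one (-(a : ℤ)) (b + 1)
    have i1 := ih b
    have i2 := ih (b + 1)
    have hb := negX_succ b
    push_cast at i2 ⊢
    rw [show (-((a : ℤ) + 1)) + 1 = -a by ring, neg_neg] at s1
    rw [add_sub_cancel_right] at r2 s2
    rw [show (-(a : ℤ)) - 1 = -((a : ℤ) + 1) by ring, neg_neg] at s2
    rw [show (a : ℤ) - (b + 1) = a - b - 1 by ring] at i2
    rw [show (a : ℤ) - b + 1 = a + 1 - b by ring] at r1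
    have c1 := single_mul_cancel (b : ℤ)
    have c2 : (single (-((b : ℤ) + 1)) 1 * single 1 1 : ℤ⸨X⸩) = single (-(b : ℤ)) 1 := by
      rw [single_mul_single]; simp
    have c3 : (single ((a : ℤ) - b) 1 : ℤ⸨X⸩) = single (a : ℤ) 1 * single (-(b : ℤ)) 1 := by
      rw [single_mul_single]; simp [sub_eq_add_neg]
    have c4 : (single ((a : ℤ) + 1) 1 : ℤ⸨X⸩) = single (a : ℤ) 1 * single 1 1 := by
      rw [single_mul_single]; simp
    have c5 : (single ((b : ℤ) + 1) 1 : ℤ⸨X⸩) = single (b : ℤ) 1 * single 1 1 := by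
      rw [single_mul_single]; simp
    rw [c3] at r1 r2
    rw [c4] at s1
    rw [c5] at s2
    rw [i1] at r1 r2
    rw [i2, hb, s2] at r2
    rw [s1]
    rw [r2] at r1
    generalize (single (a : ℤ) 1 : ℤ⸨X⸩) = A at *
    generalize (single (b : ℤ) 1 : ℤ⸨X⸩) = B at *
    generalize (single (-(b : ℤ)) 1 : ℤ⸨X⸩) = B' at *
    generalize (single (-((b : ℤ) + 1)) 1 : ℤ⸨X⸩) = C at *
    generalize (single (1 : ℤ) 1 : ℤ⸨X⸩) = x at *
    generalize negX b = N at *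
    generalize IΔ (-a) b = p at *
    generalize IΔ (-(a + 1)) (b + 1) = r at *
    generalize IΔ b (a + 1 - b) = t at *
    -- The target value `t` has coefficient `B' = B⁻¹` in `r1`, so multiplying by `B` isolates it.
    have h : B * B' * t = B * (N * p) -
        A * (B * B') * (A * B' * (N * p) - C * x * (N * (B * x * r + A * p))) := by
      linear_combination (-B) * r1
    rw [c1, c2] at h
    linear_combination h + A * N * x * r * c1

/-! ### Lower bounds for orders and summability -/

lemma coe_le_orderTop_iff {x : ℤ⸨X⸩} {d : ℤ} :
    (d : WithTop ℤ) ≤ x.orderTop ↔ ∀ k < d, x.coeff k = 0 := by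
  simp [le_orderTop_iff_forall]

lemma coe_add_le_orderTop_mul {x y : ℤ⸨X⸩} {d d' : ℤ} (hx : (d : WithTop ℤ) ≤ x.orderTop)
    (hy : (d' : WithTop ℤ) ≤ y.orderTop) : ((d + d' : ℤ) : WithTop ℤ) ≤ (x * y).orderTop := by
  rw [WithTop.coe_add]
  exact (add_le_add hx hy).trans orderTop_add_le_mul

lemma coe_sum_le_orderTop_prod {ι : Type*} (s : Finset ι) (x : ι → ℤ⸨X⸩) (d : ι → ℤ)
    (h : ∀ i ∈ s, (d i : WithTop ℤ) ≤ (x i).orderTop) :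
    ((∑ i ∈ s, d i : ℤ) : WithTop ℤ) ≤ (∏ i ∈ s, x i).orderTop := by
  classical
  induction s using Finset.induction_on with
  | empty => simp
  | insert i s hi ih =>
    rw [Finset.sum_insert hi, Finset.prod_insert hi]
    exact coe_add_le_orderTop_mul (h i (Finset.mem_insert_self i s))
      (ih fun j hj => h j (Finset.mem_insert_of_mem hj))

lemma le_orderTop_negX (k : ℤ) : (k : WithTop ℤ) ≤ (negX k).orderTop :=
  orderTop_single_le

/-- The factors `1/(q)_k` are power series, so the monomial prefactors control the order of each
term. Only indices with `0 ≤ n + e` contribute. -/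
lemma le_orderTop_IΔ (m e d : ℤ)
    (h : ∀ n : ℕ, 0 ≤ (n : ℤ) + e → d ≤ (n : ℤ) * (n + 1) - (2 * n + e) * m) :
    (d : WithTop ℤ) ≤ (IΔ m e).orderTop := by
  rw [coe_le_orderTop_iff]
  intro k hk
  rw [IΔ, SummableFamily.coeff_hsum]
  refine finsum_eq_zero_of_forall_eq_zero fun n => ?_
  by_contra hne
  rw [family_apply] at hne
  have h1 := le_of_coeff_term_ne m e n k hne
  have h2 : 0 ≤ (n : ℤ) + e := by
    by_contra h2
    rw [term, if_neg h2] at hne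
    exact hne rfl
  linarith [h n h2]

lemma le_orderTop_IΔ_neg (a b : ℕ) : ((a * b : ℤ) : WithTop ℤ) ≤ (IΔ (-a) b).orderTop := by
  refine le_orderTop_IΔ _ _ _ fun n _ => ?_
  have h1 : (0 : ℤ) ≤ (n : ℤ) * (n + 1) := by positivity
  have h2 : (0 : ℤ) ≤ (n : ℤ) * a := by positivity
  linarith

/-- The degree of `J_Δ(a, b, c)` is at least `ab + bc + ca` if `min(a, b, c) = 0`. -/
lemma le_orderTop_JΔ (a b c : ℤ) (h : min a (min b c) = 0) :
    ((a * b + b * c + c * a : ℤ) : WithTop ℤ) ≤ (JΔ a b c).orderTop := by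
  have ha : 0 ≤ a := by omega
  have hb : 0 ≤ b := by omega
  have hc : 0 ≤ c := by omega
  lift a to ℕ using ha
  lift b to ℕ using hb
  lift c to ℕ using hc
  rcases (by omega : a = 0 ∨ b = 0 ∨ c = 0) with rfl | rfl | rfl
  · have h1 : ((b + b * c : ℤ) : WithTop ℤ) ≤ (IΔ (b - c) ((0 : ℕ) - b)).orderTop := by
      refine le_orderTop_IΔ _ _ _ fun n hn => ?_
      -- Here `e = -b`, so the sum starts at `n = b`, and the exponent becomes `k(k+1) + b + bc +
      -- 2kc`.
      obtain ⟨k, rfl⟩ : ∃ k, n = b + k := ⟨n - b, by omega⟩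
      have h1 : (0 : ℤ) ≤ (k : ℤ) * (k + 1) := by positivity
      have h2 : (0 : ℤ) ≤ (k : ℤ) * c := by positivity
      push_cast
      linarith
    convert coe_add_le_orderTop_mul (le_orderTop_negX (-b)) h1 using 2
    · push_cast; ring
    · rfl
  · have h1 := le_orderTop_IΔ_neg c a
    convert h1 using 2
    · push_cast; ring
    · simp [JΔ, negX_zero]
  · have h1 := le_orderTop_IΔ_neg a b
    convert h1 using 2
    · push_cast; ring
    -- For `c = 0` individual terms can have order below the bound; the symmetry replaces the series
    -- by one without this defect.
    · rw [JΔ, Nat.cast_zero, sub_zero, IΔ_symm, ← mul_assoc, negX_mul, neg_add_cancel, negX_zero,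
        one_mul]

end TetIndex

/-- A family of Laurent series with finitely many members of each bounded degree is summable. -/
lemma exists_hasLaurentSum {ι : Type*} (f : ι → ℤ⸨X⸩) (d : ι → ℤ)
    (hd : ∀ i, (d i : WithTop ℤ) ≤ (f i).orderTop) (hfin : ∀ D : ℤ, {i | d i ≤ D}.Finite) :
    ∃ L, HasLaurentSum f L := by
  have hcoeff : ∀ i k, (f i).coeff k ≠ 0 → d i ≤ k := by
    intro i k hk
    by_contra h
    exact hk (TetIndex.coe_le_orderTop_iff.1 (hd i) k (not_le.1 h))
  let F : HahnSeries.SummableFamily ℤ ℤ ι :=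
    { toFun := f
      isPWO_iUnion_support' := by
        -- Only finitely many members have `d i ≤ 0`, so all supports share a lower bound.
        obtain ⟨B, hB⟩ := ((hfin 0).image d).bddBelow
        refine (BddBelow.isWF ⟨min B 0, fun k hk => ?_⟩).isPWO
        obtain ⟨i, hi⟩ := Set.mem_iUnion.1 hk
        have h1 := hcoeff i k hi
        by_cases h0 : d i ≤ 0
        · exact (min_le_left _ _).trans ((hB ⟨i, h0, rfl⟩).trans h1)
        · exact (min_le_right _ _).trans (by omega)
      finite_co_support' := fun k => (hfin k).subset fun i hi => hcoeff i k hi }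
  refine ⟨F.hsum, fun D => ⟨(hfin D).toFinset, fun s hs k hk => ?_⟩⟩
  rw [HahnSeries.SummableFamily.coeff_hsum_eq_sum_of_subset (t := s), HahnSeries.coeff_sum]
  · rfl
  · intro i hi
    refine hs ((hfin D).mem_toFinset.2 ?_)
    exact (hcoeff i k hi).trans hk

namespace IdealTriangulation

variable {n : ℕ} (T : IdealTriangulation n)

/-! ## Non-negative classes with given boundary -/

/-- The integer quad coordinates given by natural numbers. -/
def natCoord : (Fin n → Fin 3 → ℕ) →+ (Fin n → Fin 3 → ℤ) where
  toFun s := fun t q => s t q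
  map_zero' := by ext; simp
  map_add' s s' := by ext; simp

lemma exists_natCoord_eq (S : Fin n → Fin 3 → ℤ) (hS : ∀ t q, 0 ≤ S t q) :
    ∃ s, natCoord s = S :=
  ⟨fun t q => (S t q).toNat, by ext t q; exact Int.toNat_of_nonneg (hS t q)⟩

lemma natCoord_nonneg (s : Fin n → Fin 3 → ℕ) (t q) : 0 ≤ natCoord s t q :=
  Int.natCast_nonneg _

lemma natCoord_add_sub (s s' : Fin n → Fin 3 → ℕ) :
    natCoord s' = natCoord (s + s') - natCoord s := by
  rw [map_add, add_sub_cancel_left]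

/-- Natural quad coordinates of solutions with vanishing boundary class. -/
def closedNat : AddSubmonoid (Fin n → Fin 3 → ℕ) where
  carrier := {s | ∃ h : natCoord s ∈ T.Q, T.bdryClass ⟨natCoord s, h⟩ = 0}
  zero_mem' := ⟨by rw [map_zero]; exact zero_mem _, map_zero T.bdryClass⟩
  add_mem' := by
    rintro s s' ⟨h, h0⟩ ⟨h', h0'⟩
    have e : natCoord (s + s') = natCoord s + natCoord s' := map_add _ _ _
    refine ⟨e ▸ add_mem h h', ?_⟩
    have h2 := map_add T.bdryClass ⟨natCoord s, h⟩ ⟨natCoord s', h'⟩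
    rw [h0, h0', add_zero] at h2
    rw [← h2]
    exact congrArg T.bdryClass (Subtype.ext e)

/-- Gordan's lemma: membership is a condition of lying in the kernel of a homomorphism, so
differences that stay in the natural numbers remain in the monoid, and such submonoids are finitely
generated. -/
lemma closedNat_fg : T.closedNat.FG := by
  refine AddSubmonoid.fg_of_subtractive ?_
  rintro s ⟨h, h0⟩ s' ⟨h', h0'⟩
  have e := natCoord_add_sub s s'
  refine ⟨e ▸ sub_mem h' h, ?_⟩
  have h2 := map_sub T.bdryClass ⟨natCoord (s + s'), h'⟩ ⟨natCoord s, h⟩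
  rw [h0, h0', sub_zero] at h2
  rw [← h2]
  exact congrArg T.bdryClass (Subtype.ext e)

/-- The solution with given natural quad coordinates. -/
def closedNatToQ : T.closedNat →+ T.Q where
  toFun s := ⟨natCoord s.1, s.2.1⟩
  map_zero' := Subtype.ext (map_zero natCoord)
  map_add' s s' := Subtype.ext (map_add natCoord s.1 s'.1)

/-- The non-negative solutions with vanishing boundary class form a finitely generated monoid. -/
lemma exists_closed_generators : ∃ G : Finset T.Q,
    (∀ g ∈ G, (∀ t q, 0 ≤ g.1 t q) ∧ T.bdryClass g = 0 ∧ g ≠ 0) ∧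
    ∀ S : T.Q, (∀ t q, 0 ≤ S.1 t q) → T.bdryClass S = 0 →
      ∃ c : T.Q → ℕ, S = ∑ g ∈ G, c g • g := by
  classical
  have hfg : (⊤ : AddSubmonoid T.closedNat).FG :=
    (AddMonoid.fg_def).1 ((AddMonoid.fg_iff_addSubmonoid_fg _).2 T.closedNat_fg)
  obtain ⟨G, hG⟩ := hfg.map T.closedNatToQ
  -- Zero is discarded because the positivity hypothesis concerns non-zero classes only.
  refine ⟨G.erase 0, fun g hg => ?_, fun S hS h0 => ?_⟩
  · rw [Finset.mem_erase] at hg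
    have : g ∈ AddSubmonoid.closure (G : Set T.Q) := AddSubmonoid.subset_closure hg.2
    rw [hG] at this
    obtain ⟨s, -, rfl⟩ := this
    exact ⟨natCoord_nonneg s.1, s.2.2, hg.1⟩
  · obtain ⟨s, hs⟩ := exists_natCoord_eq S.1 hS
    have hmem : S ∈ AddSubmonoid.closure (G : Set T.Q) := by
      rw [hG]
      have hsQ : natCoord s ∈ T.Q := hs ▸ S.2
      have e : (⟨natCoord s, hsQ⟩ : T.Q) = S := Subtype.ext hs
      exact ⟨⟨s, hsQ, by rw [e, h0]⟩, trivial, e⟩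
    obtain ⟨c, -, hc⟩ := AddSubmonoid.mem_closure_finset.1 hmem
    refine ⟨c, ?_⟩
    rw [← hc]
    exact (Finset.sum_erase (f := fun g : T.Q => c g • g) G (smul_zero (c 0))).symm

/-- Finitely many non-negative solutions with boundary class `b` lie below all of them. -/
lemma exists_finite_minimal (b : T.H1) : ∃ M : Set T.Q, M.Finite ∧
    (∀ S ∈ M, (∀ t q, 0 ≤ S.1 t q) ∧ T.bdryClass S = b) ∧
    ∀ S : T.Q, (∀ t q, 0 ≤ S.1 t q) → T.bdryClass S = b →
      ∃ S₀ ∈ M, ∀ t q, S₀.1 t q ≤ S.1 t q := by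
  let A : Set (Fin n → Fin 3 → ℕ) := {s | ∃ h : natCoord s ∈ T.Q, T.bdryClass ⟨natCoord s, h⟩ = b}
  -- Dickson's lemma: the minimal elements form an antichain in a well-quasi-order.
  have hfin : {s | Minimal (· ∈ A) s}.Finite :=
    WellQuasiOrderedLE.finite_of_isAntichain (setOfPred_minimal_antichain _)
  refine ⟨{S | ∃ s, Minimal (· ∈ A) s ∧ natCoord s = S.1}, ?_, ?_, ?_⟩
  · refine ((hfin.image natCoord).preimage Subtype.val_injective.injOn).subset ?_
    rintro S ⟨s, hs, h⟩
    exact ⟨s, hs, h⟩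
  · rintro S ⟨s, ⟨⟨h, hb⟩, -⟩, hS⟩
    refine ⟨fun t q => hS ▸ natCoord_nonneg s t q, ?_⟩
    rw [← hb]
    exact congrArg _ (Subtype.ext hS.symm)
  · intro S hS hb
    obtain ⟨s, hs⟩ := exists_natCoord_eq S.1 hS
    have hsA : s ∈ A := ⟨hs ▸ S.2, by
      rw [← hb]
      exact congrArg _ (Subtype.ext hs)⟩
    obtain ⟨m, hm, hmin⟩ := (Set.isPWO_of_wellQuasiOrderedLE A).exists_le_minimal hsA
    refine ⟨⟨natCoord m, hmin.1.1⟩, ⟨m, hmin, rfl⟩, fun t q => ?_⟩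
    rw [← hs]
    exact Int.ofNat_le.2 (hm t q)

/-! ## The degree function -/

/-- Twice the bilinear form associated with the double arc function. -/
def arcPairing (S S' : Fin n → Fin 3 → ℤ) : ℤ :=
  ∑ t, ((S t 0 * S' t 1 + S t 1 * S' t 2 + S t 2 * S' t 0) +
    (S' t 0 * S t 1 + S' t 1 * S t 2 + S' t 2 * S t 0))

lemma two_mul_doubleArcBilin (S S' : Fin n → Fin 3 → ℤ) :
    2 * doubleArcBilin S S' = (arcPairing S S' : ℚ) := by
  rw [doubleArcBilin, arcPairing]
  push_cast
  ring

lemma arcPairing_add_left (S S' S'' : Fin n → Fin 3 → ℤ) :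
    arcPairing (S + S') S'' = arcPairing S S'' + arcPairing S' S'' := by
  simp only [arcPairing, ← Finset.sum_add_distrib, Pi.add_apply]
  exact Finset.sum_congr rfl fun t _ => by ring

lemma arcPairing_nonneg (S S' : Fin n → Fin 3 → ℤ) (hS : ∀ t q, 0 ≤ S t q)
    (hS' : ∀ t q, 0 ≤ S' t q) : 0 ≤ arcPairing S S' := by
  refine Finset.sum_nonneg fun t _ => ?_
  positivity [hS t 0, hS t 1, hS t 2, hS' t 0, hS' t 1, hS' t 2]

lemma doubleArc_add_nsmul (S S' : Fin n → Fin 3 → ℤ) (c : ℕ) :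
    doubleArc (S + c • S') = doubleArc S + c * arcPairing S S' + c ^ 2 * doubleArc S' := by
  simp only [doubleArc, arcPairing, Finset.mul_sum, ← Finset.sum_add_distrib, Pi.add_apply,
    Pi.smul_apply]
  exact Finset.sum_congr rfl fun t _ => by simp only [nsmul_eq_mul]; ring

lemma doubleArc_nonneg (S : Fin n → Fin 3 → ℤ) (hS : ∀ t q, 0 ≤ S t q) : 0 ≤ doubleArc S :=
  Finset.sum_nonneg fun t _ => add_nonneg (add_nonneg (mul_nonneg (hS t 0) (hS t 1))
    (mul_nonneg (hS t 1) (hS t 2))) (mul_nonneg (hS t 2) (hS t 0))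

/-- A vanishing sum of non-negative products forces each product of two quad coordinates in a
tetrahedron to vanish. -/
lemma isEmbedded_of_doubleArc (S : Fin n → Fin 3 → ℤ) (hS : ∀ t q, 0 ≤ S t q)
    (h : doubleArc S = 0) : IsEmbedded S := by
  intro t
  have h01 := mul_nonneg (hS t 0) (hS t 1)
  have h12 := mul_nonneg (hS t 1) (hS t 2)
  have h20 := mul_nonneg (hS t 2) (hS t 0)
  have ht := (Finset.sum_eq_zero_iff_of_nonneg fun t _ =>
    add_nonneg (add_nonneg (mul_nonneg (hS t 0) (hS t 1))
    (mul_nonneg (hS t 1) (hS t 2))) (mul_nonneg (hS t 2) (hS t 0))).1 h t (Finset.mem_univ t)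
  have e01 : S t 0 = 0 ∨ S t 1 = 0 := mul_eq_zero.1 (by linarith)
  have e12 : S t 1 = 0 ∨ S t 2 = 0 := mul_eq_zero.1 (by linarith)
  have e20 : S t 2 = 0 ∨ S t 0 = 0 := mul_eq_zero.1 (by linarith)
  intro q q' hq hq'
  fin_cases q <;> fin_cases q' <;> first | rfl | (simp at hq hq' ⊢; tauto)

/-- If a 2-chain `y` on the boundary surface bounds the boundary chain of `S`, then `-y` serves as
triangle coordinates: the equation at each side is Haken's matching equation for that normal arc. -/
lemma isClosedClass_of_bdryClass (S : T.Q) (h : T.bdryClass S = 0) : T.IsClosedClass S.1 := by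
  obtain ⟨y, hy⟩ : T.bdryChain S.1 ∈ LinearMap.range T.bdry2 :=
    (Submodule.Quotient.mk_eq_zero ((LinearMap.range T.bdry2).comap T.Z1.subtype)).1 h
  refine ⟨-y, fun x => ?_⟩
  have := congrFun hy x
  simp only [bdry2, bdryChain, LinearMap.coe_mk, AddHom.coe_mk] at this
  simp only [Pi.neg_apply]
  linarith

/-- The quantity `-χ(S) + δ(S)`, a lower bound for the degree of `I(S)`. -/
noncomputable def indexDegree (S : T.Q) : ℤ := - T.eulerChar S + doubleArc S.1

/-- Expanding the quadratic form `doubleArc`, the pairings between distinct generators are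
non-negative and can be dropped; what remains separates into functions of single coefficients. -/
lemma indexDegree_add_sum_ge (S₀ : T.Q) (G : Finset T.Q) (hG : ∀ g ∈ G, ∀ t q, 0 ≤ g.1 t q)
    (c : T.Q → ℕ) :
    T.indexDegree S₀ + ∑ g ∈ G, ((c g : ℤ) * (- T.eulerChar g + arcPairing S₀.1 g.1) +
      (c g : ℤ) ^ 2 * doubleArc g.1) ≤ T.indexDegree (S₀ + ∑ g ∈ G, c g • g) := by
  classical
  induction G using Finset.induction_on with
  | empty => simp
  | insert g G hg ih =>
    have ih := ih fun g hg => hG g (Finset.mem_insert_of_mem hg)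
    have hR : 0 ≤ arcPairing (∑ g ∈ G, c g • g : T.Q).1 g.1 := by
      refine arcPairing_nonneg _ _ (fun t q => ?_) (hG g (Finset.mem_insert_self _ _))
      have : (∑ g ∈ G, c g • g : T.Q).1 t q = ∑ g ∈ G, c g * g.1 t q := by
        simp [Finset.sum_apply]
      rw [this]
      exact Finset.sum_nonneg fun g' hg' =>
        mul_nonneg (Int.natCast_nonneg _) (hG g' (Finset.mem_insert_of_mem hg') t q)
    rw [Finset.sum_insert hg, Finset.sum_insert hg]
    generalize (∑ g ∈ G, c g • g : T.Q) = R at *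
    rw [show S₀ + (c g • g + R) = (S₀ + R) + c g • g by abel]
    have h1 : T.indexDegree (S₀ + R + c g • g) = T.indexDegree (S₀ + R) +
        ((c g : ℤ) * (- T.eulerChar g + arcPairing S₀.1 g.1) + (c g : ℤ) ^ 2 * doubleArc g.1) +
        c g * arcPairing R.1 g.1 := by
      have h2 : (S₀ + R + c g • g : T.Q).1 = (S₀.1 + R.1) + c g • g.1 := rfl
      have h3 : (S₀ + R : T.Q).1 = S₀.1 + R.1 := rfl
      rw [indexDegree, indexDegree, h2, h3, doubleArc_add_nsmul, arcPairing_add_left,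
        map_add _ _ (c g • g), map_nsmul, nsmul_eq_mul]
      ring
    have h4 : 0 ≤ (c g : ℤ) * arcPairing R.1 g.1 := mul_nonneg (Int.natCast_nonneg _) hR
    linarith

/-! ### Coercivity and finiteness -/

/-- A lower bound independent of `c`, so that one summand can be bounded above without knowing the
others. -/
lemma neg_sq_le_quadratic (c w d : ℤ) (hc : 0 ≤ c) (hd : 0 ≤ d) (h : d = 0 → 0 < w) :
    -w ^ 2 ≤ c * w + c ^ 2 * d := by
  rcases hd.eq_or_lt with rfl | hd
  · have := mul_nonneg hc (h rfl).le
    nlinarith [sq_nonneg w]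
  · have : c ^ 2 ≤ c ^ 2 * d := le_mul_of_one_le_right (sq_nonneg c) hd
    nlinarith [sq_nonneg (c + w), sq_nonneg c, sq_nonneg w]

/-- For `d = 0` integrality gives `w ≥ 1`, hence `c ≤ E`. For `d ≥ 1`, if `c` exceeded `|w| + |E|`,
then `c(c + w) ≥ c + w > |E|`. -/
lemma le_of_quadratic_le (c w d E : ℤ) (hc : 0 ≤ c) (hd : 0 ≤ d) (h : d = 0 → 0 < w)
    (hE : c * w + c ^ 2 * d ≤ E) : c ≤ |w| + |E| := by
  have h1 := le_abs_self E
  have h2 := neg_abs_le w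
  have h3 := abs_nonneg w
  have h4 := abs_nonneg E
  by_contra hlt
  rcases hd.eq_or_lt with rfl | hd
  · have : c * 1 ≤ c * w := mul_le_mul_of_nonneg_left (h rfl) hc
    linarith
  · have h5 : c ^ 2 ≤ c ^ 2 * d := le_mul_of_one_le_right (sq_nonneg c) hd
    have h6 : 1 * (c + w) ≤ c * (c + w) :=
      mul_le_mul_of_nonneg_right (by linarith) (by linarith)
    nlinarith

/-- Under the hypothesis of the main theorem only finitely many non-negative solutions with
boundary class `b` have bounded degree. -/
lemma finite_indexDegree_le (b : T.H1)
    (hT : ∀ S S' : T.Q, (∀ t q, 0 ≤ S.1 t q) → T.bdryClass S = b → (∀ t q, 0 ≤ S'.1 t q) →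
      T.IsClosedClass S'.1 → IsEmbedded S'.1 → S' ≠ 0 →
      0 < - T.eulerChar S' + arcPairing S.1 S'.1) (D : ℤ) :
    {S : T.Q | (∀ t q, 0 ≤ S.1 t q) ∧ T.bdryClass S = b ∧ T.indexDegree S ≤ D}.Finite := by
  classical
  obtain ⟨G, hG, hgen⟩ := T.exists_closed_generators
  obtain ⟨M, hM, hMb, hmin⟩ := T.exists_finite_minimal b
  let w : T.Q → T.Q → ℤ := fun S₀ g => - T.eulerChar g + arcPairing S₀.1 g.1
  -- An upper bound for any single summand: all of them together are at most `D - T.indexDegree S₀`,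
  -- and each of the others is at least `-w S₀ g ^ 2`.
  let E : T.Q → ℤ := fun S₀ => D - T.indexDegree S₀ + ∑ g ∈ G, w S₀ g ^ 2
  let K : T.Q → T.Q → ℕ := fun S₀ g => (|w S₀ g| + |E S₀|).toNat
  have hfin : (⋃ S₀ ∈ M, (fun c : G → ℕ => S₀ + ∑ g : G, c g • (g : T.Q)) ''
      (Set.Iic fun g : G => K S₀ g)).Finite :=
    hM.biUnion fun S₀ _ => (Set.finite_Iic _).image _
  refine hfin.subset ?_
  rintro S ⟨hS, hb, hD⟩
  obtain ⟨S₀, hS₀, hle⟩ := hmin S hS hb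
  obtain ⟨hpos, hb₀⟩ := hMb S₀ hS₀
  obtain ⟨c, hc⟩ := hgen (S - S₀) (fun t q => sub_nonneg.2 (hle t q)) (by
    rw [map_sub, hb, hb₀, sub_self])
  have hSc : S = S₀ + ∑ g ∈ G, c g • g := by rw [← hc]; abel
  -- The only use of the hypothesis of the theorem, with `S = S₀` and `S' = g`.
  have hd : ∀ g ∈ G, doubleArc g.1 = 0 → 0 < w S₀ g := fun g hg h0 =>
    hT S₀ g hpos hb₀ (hG g hg).1 (T.isClosedClass_of_bdryClass g (hG g hg).2.1)
      (isEmbedded_of_doubleArc g.1 (hG g hg).1 h0) (hG g hg).2.2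
  have hge := T.indexDegree_add_sum_ge S₀ G (fun g hg => (hG g hg).1) c
  rw [← hSc] at hge
  rw [Set.mem_iUnion₂]
  refine ⟨S₀, hS₀, fun g => c g, fun g => ?_, ?_⟩
  -- Adding `w S₀ g ^ 2` makes all summands non-negative, so that a single one is bounded by the
  -- sum.
  · have h1 : ∀ g ∈ G, 0 ≤ (c g * w S₀ g + (c g : ℤ) ^ 2 * doubleArc g.1) + w S₀ g ^ 2 := by
      intro g hg
      have := neg_sq_le_quadratic (c g) (w S₀ g) (doubleArc g.1) (Int.natCast_nonneg _)
        (doubleArc_nonneg g.1 (hG g hg).1) (hd g hg)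
      linarith
    have h2 := Finset.single_le_sum h1 g.2
    rw [Finset.sum_add_distrib] at h2
    have h3 : c g * w S₀ g + (c g : ℤ) ^ 2 * doubleArc g.1.1 ≤ E S₀ := by
      have := sq_nonneg (w S₀ g)
      simp only [E]
      linarith
    have := le_of_quadratic_le (c g) (w S₀ g) (doubleArc g.1.1) (E S₀) (Int.natCast_nonneg _)
      (doubleArc_nonneg g.1.1 (hG g g.2).1) (hd g g.2) h3
    exact Int.le_toNat (by positivity) |>.2 this
  · change S₀ + ∑ g : G, c g • (g : T.Q) = S
    rw [hSc, Finset.sum_coe_sort G fun g => c g • g]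

/-! ### Minimal representatives and convergence -/

/-- The minimal representative has minimum zero in each tetrahedron, as the bound for `JΔ` requires;
the orders of the factors then add up to `-χ + δ`. -/
lemma indexDegree_le_orderTop (S : T.Q) :
    (T.indexDegree (T.minRep S) : WithTop ℤ) ≤ (T.surfaceIndex (T.minRep S)).orderTop := by
  refine TetIndex.coe_add_le_orderTop_mul (TetIndex.le_orderTop_negX _)
    (TetIndex.coe_sum_le_orderTop_prod _ _ _ fun t _ => TetIndex.le_orderTop_JΔ _ _ _ ?_)
  simp only [minRep, minFun]
  omega

lemma minRep_nonneg (S : T.Q) (t : Fin n) (q : Fin 3) : 0 ≤ (T.minRep S).1 t q := by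
  simp only [minRep, minFun]
  fin_cases q <;> simp

lemma mk_minRep (S : T.Q) : T.tetSub.mkQ (T.minRep S) = T.tetSub.mkQ S := by
  refine (Submodule.Quotient.eq _).2 ?_
  have h : (T.minRep S - S : T.Q).1 =
      ∑ j, (-(min (S.1 j 0) (min (S.1 j 1) (S.1 j 2)))) • tetSol j := by
    ext t q
    simp [minRep, minFun, tetSol, Finset.sum_apply]
  change (T.minRep S - S : T.Q).1 ∈ Submodule.span ℤ (Set.range (tetSol (n := n)))
  rw [h]
  exact Submodule.sum_mem _ fun j _ => Submodule.smul_mem _ _ (Submodule.subset_span ⟨j, rfl⟩)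

lemma bdryClass_of_homClass (S : T.Q) (a : T.H2) (b : T.H1)
    (h : T.homClass (T.tetSub.mkQ S) = (a, b)) : T.bdryClass S = b :=
  congrArg Prod.snd h

end IdealTriangulation

theorem mainTheorem7 {n : ℕ} (T : IdealTriangulation n) (a : T.H2) (b : T.H1)
    (hT : ¬ ∃ S S' : T.Q,
      (∀ t q, 0 ≤ S.1 t q) ∧ T.bdryClass S = b ∧
      (∀ t q, 0 ≤ S'.1 t q) ∧ T.IsClosedClass S'.1 ∧ IdealTriangulation.IsEmbedded S'.1 ∧ S' ≠ 0 ∧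
      -(T.eulerChar S' : ℚ) + 2 * IdealTriangulation.doubleArcBilin S.1 S'.1 ≤ 0) :
    T.IndexSumConverges a b := by
  have hfin := T.finite_indexDegree_le b (by
    intro S S' h1 h2 h3 h4 h5 h6
    by_contra hle
    refine hT ⟨S, S', h1, h2, h3, h4, h5, h6, ?_⟩
    rw [IdealTriangulation.two_mul_doubleArcBilin]
    exact_mod_cast not_lt.1 hle)
  have hrep : ∀ c : T.Q ⧸ T.tetSub, ∃ S : T.Q, T.tetSub.mkQ (T.minRep S) = c ∧
      T.classIndex c = T.surfaceIndex (T.minRep S) := by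
    intro c
    obtain ⟨S, rfl⟩ := T.tetSub.mkQ_surjective c
    exact ⟨S, T.mk_minRep S, rfl⟩
  choose r hr hI using hrep
  refine exists_hasLaurentSum _ (fun c => T.indexDegree (T.minRep (r c.1))) (fun c => ?_)
    fun D => ?_
  · rw [hI]
    exact T.indexDegree_le_orderTop _
  -- A class is recovered from its minimal representative, so the finite set of solutions of degree
  -- at most `D` bounds the classes; prescribing `a` just selects some of the classes with boundary
  -- `b`.
  · refine Set.Finite.of_finite_image ((hfin D).subset ?_)
      (f := fun c => T.minRep (r c.1)) fun c _ c' _ h => Subtype.ext ?_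
    · rintro _ ⟨c, hc, rfl⟩
      refine ⟨T.minRep_nonneg _, T.bdryClass_of_homClass _ a b ?_, hc⟩
      rw [hr]
      exact c.2
    · rw [← hr c.1, ← hr c'.1]
      exact congrArg _ h
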